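/- Let $H:\mathbb{C}^2\to\mathbb{C}^2$, $H(z,w)=(p(z)+\delta w,\,z)$, be a Hénon map, where $p$ is a complex polynomial of degree $d\ge 2$ and $\delta\in\mathbb{C}\setminus\{0\}$. Then the Green function $$G_H^+(z,w)=\lim_{n\to\infty}\frac1{d^n}\log^+\lVert H^n(z,w)\rVert,\qquad \log^+x=\max\{\log x,0\},$$ is well defined (the limit exists and is finite at every point of $\mathbb{C}^2$), and for every $r>0$ the sublevel set $$\Omega_r=\{(z,w)\in\mathbb{C}^2: G_H^+(z,w)<r\}$$ is a Loewner Short $\mathbb{C}^2$. Here, for $k\ge2$, a set $\Omega\subseteq\mathbb{C}^k$ is a *Short* $\mathbb{C}^k$ if $\Omega$ is the union of an increasing sequence of domains each biholomorphic to the unit ball of $\mathbb{C}^k$, the infinitesimal Kobayashi metric of $\Omega$ vanishes identically, and there is a non-constant plurisubharmonic function on $\Omega$ that is bounded above. A Short $\mathbb{C}^k$ $\Omega$ is *Loewner* if there are domains $\Omega_t\subseteq\mathbb{C}^k$, $t\ge0$, such that 1. $\Omega=\bigcup_{t\ge0}\Omega_t$, and either every $\Omega_t$ is biholomorphic to the unit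 ball of $\mathbb{C}^k$, or every $\Omega_t$ is biholomorphic to the unit polydisc of $\mathbb{C}^k$; 2. $\Omega_t\subset\subset\Omega_s$ (the closure of $\Omega_t$ is compact and contained in $\Omega_s$) whenever $0\le t<s$; 3. $\Omega_t=\bigcup_{0\le t'<t}\Omega_{t'}$ for every $t>0$; 4. $\overline{\Omega_{t'}}=\bigcap_{t>t'}\Omega_t$ for every $t'\ge0$. -/

import Mathlib

open scoped NNReal ENNReal Topology Polynomial

noncomputable section

namespace ShortC

/-- `ℂ^k` with its Euclidean norm. -/
abbrev Cn (k : ℕ) : Type := EuclideanSpace ℂ (Fin k)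

/-- The open unit ball of `ℂ^k`. -/
def unitBall (k : ℕ) : Set (Cn k) := Metric.ball 0 1

/-- The open unit polydisc of `ℂ^k`. -/
def unitPolydisc (k : ℕ) : Set (Cn k) := {z | ∀ i, ‖z i‖ < 1}

/-- Two open subsets of `ℂ^k` are biholomorphic: there is a holomorphic bijection from one onto the
other whose inverse is holomorphic. -/
def Biholomorphic {k : ℕ} (U V : Set (Cn k)) : Prop :=
  IsOpen U ∧ IsOpen V ∧ ∃ f g : Cn k → Cn k,
    DifferentiableOn ℂ f U ∧ DifferentiableOn ℂ g V ∧
    Set.MapsTo f U V ∧ Set.MapsTo g V U ∧ Set.LeftInvOn g f U ∧ Set.RightInvOn g f V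

/-- The infinitesimal Kobayashi (Kobayashi-Royden) metric of `Ω` at the point `p` in the direction
`v`: the infimum of the numbers `α > 0` for which there is a holomorphic map `f` from the open unit
disc to `Ω` with `f 0 = p` and `α f'(0) = v`. -/
def kobayashiMetric {k : ℕ} (Ω : Set (Cn k)) (p v : Cn k) : ℝ≥0∞ :=
  sInf {a : ℝ≥0∞ | ∃ (α : ℝ) (f : ℂ → Cn k), 0 < α ∧ a = ENNReal.ofReal α ∧
    DifferentiableOn ℂ f (Metric.ball 0 1) ∧ Set.MapsTo f (Metric.ball 0 1) Ω ∧
    f 0 = p ∧ (α : ℂ) • deriv f 0 = v}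

/-- The mean over the unit circle of an extended-real function that is bounded above there: mean of
the positive part (finite) minus mean of the negative part (possibly infinite). -/
def circleMean (v : ℂ → EReal) : EReal :=
  let μ : MeasureTheory.Measure ℝ := MeasureTheory.volume.restrict (Set.Ioc 0 (2 * Real.pi))
  (MeasureTheory.laverage μ (fun θ => (v (circleMap 0 1 θ)).toENNReal) : EReal) -
    (MeasureTheory.laverage μ (fun θ => (-v (circleMap 0 1 θ)).toENNReal) : EReal)

/-- `u` is plurisubharmonic on `Ω`: it takes values in `[-∞, ∞)`, is upper semicontinuous, and
satisfies the sub-mean value inequality on every closed complex disc contained in `Ω`. -/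
structure IsPlurisubharmonicOn {k : ℕ} (u : Cn k → EReal) (Ω : Set (Cn k)) : Prop where
  ne_top : ∀ x ∈ Ω, u x ≠ ⊤
  upperSemicontinuousOn : UpperSemicontinuousOn u Ω
  le_circleMean : ∀ a b : Cn k, (∀ ζ : ℂ, ‖ζ‖ ≤ 1 → a + ζ • b ∈ Ω) →
    u a ≤ circleMean fun ζ => u (a + ζ • b)

/-- `Ω ⊆ ℂ^k`, `k ≥ 2`, is a Short `ℂ^k`: an increasing union of domains biholomorphic to the unit
ball whose Kobayashi metric vanishes identically and which carries a non-constant plurisubharmonic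
function that is bounded above. -/
structure IsShort {k : ℕ} (Ω : Set (Cn k)) : Prop where
  two_le : 2 ≤ k
  exists_exhaustion : ∃ U : ℕ → Set (Cn k), Monotone U ∧
    (∀ n, Biholomorphic (U n) (unitBall k)) ∧ Ω = ⋃ n, U n
  kobayashiMetric_eq_zero : ∀ p ∈ Ω, ∀ v : Cn k, kobayashiMetric Ω p v = 0
  exists_plurisubharmonic : ∃ u : Cn k → EReal, IsPlurisubharmonicOn u Ω ∧
    (∃ M : ℝ, ∀ x ∈ Ω, u x ≤ (M : EReal)) ∧ ∃ x ∈ Ω, ∃ y ∈ Ω, u x ≠ u y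

/-- A Short `ℂ^k` is Loewner if it is exhausted by a family of domains `D t`, `t ≥ 0`, that are all
biholomorphic to the unit ball or all biholomorphic to the unit polydisc, with `D t` relatively
compact in `D s` for `t < s`, and with the two continuity properties below. -/
structure IsLoewnerShort {k : ℕ} (Ω : Set (Cn k)) : Prop where
  isShort : IsShort Ω
  exists_family : ∃ D : ℝ≥0 → Set (Cn k),
    ((∀ t, Biholomorphic (D t) (unitBall k)) ∨ (∀ t, Biholomorphic (D t) (unitPolydisc k))) ∧
    Ω = ⋃ t, D t ∧
    (∀ t s, t < s → IsCompact (closure (D t)) ∧ closure (D t) ⊆ D s) ∧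
    (∀ t, 0 < t → D t = ⋃ t' ∈ Set.Iio t, D t') ∧
    (∀ t', closure (D t') = ⋂ t ∈ Set.Ioi t', D t)

/-- The map `(z, w) ↦ (p(z) + δ w, z)` of `ℂ²`; it is a Hénon map when `deg p ≥ 2` and `δ ≠ 0`. -/
def henon (p : ℂ[X]) (δ : ℂ) (x : Cn 2) : Cn 2 :=
  !₂[p.eval (x 0) + δ * x 1, x 0]

/-- The sequence `d^{-n} log⁺ ‖H^n(x)‖`, with `H = henon p δ` and `d = deg p`. -/
def greenSeq (p : ℂ[X]) (δ : ℂ) (x : Cn 2) (n : ℕ) : ℝ :=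
  1 / (p.natDegree : ℝ) ^ n * Real.posLog ‖(henon p δ)^[n] x‖

/-- The Green function `G_H^+`, the limit of the sequence `d^{-n} log⁺ ‖H^n(x)‖`. -/
def green (p : ℂ[X]) (δ : ℂ) (x : Cn 2) : ℝ :=
  Filter.limUnder Filter.atTop (greenSeq p δ x)

end ShortC

end

/-! Write `H` for the Hénon map and `G` for its Green function. A bound `‖H x‖ ≤ e^k max(1, ‖x‖)^d`
makes `d^{-n} (log⁺ ‖H^n‖ + c)`, with `c (d - 1) = k`, decrease to `G`. Hence `{G < r}` is the
increasing union, over large `n`, of the preimages under `H^n` of the balls of radius `exp(d^n r -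
c)`, and these are biholomorphic to balls.

As a decreasing limit of continuous functions with the sub-mean value property, `G` is
plurisubharmonic (`isPlurisubharmonicOn_green`). It is not constant on `{G < r}` since `G ∘ H = d G`
and `G` is positive somewhere (`exists_green_ne`). Near a point of `{G < r}` the automorphisms
carrying the exhausting sets to the unit ball tend uniformly to `0`, which leaves room for
arbitrarily large discs, so the Kobayashi metric vanishes (`kobayashiMetric_sublevel`).

For the Loewner family, consecutive sets of the exhaustion are joined continuously. After applying
an iterate of `H`, this means joining the ball of radius `e^L` to the `H`-preimage of the ball of
radius `e^(dL+k)`, an ellipsoid sheared by `p/δ`. The second semi-axis is enlarged until it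
dominates the shear, then the shear is performed, then the first semi-axis is enlarged. Both axes
keep growing throughout, which makes the nesting strict (`norm_interpolation_lt_one`). -/

namespace ShortC

/-! ### Automorphisms and their unit sublevel sets. -/

/-- A holomorphic automorphism of `ℂ^k`. -/
def IsAutomorphism {k : ℕ} (F : Cn k → Cn k) : Prop :=
  Differentiable ℂ F ∧ ∃ G : Cn k → Cn k,
    Differentiable ℂ G ∧ Function.LeftInverse G F ∧ Function.RightInverse G F

namespace IsAutomorphism

variable {k : ℕ} {F F' : Cn k → Cn k}

theorem comp (hF : IsAutomorphism F) (hF' : IsAutomorphism F') : IsAutomorphism (F ∘ F') := by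
  obtain ⟨h, G, hG, hl, hr⟩ := hF
  obtain ⟨h', G', hG', hl', hr'⟩ := hF'
  exact ⟨h.comp h', G' ∘ G, hG'.comp hG, hl.comp hl', hr.comp hr'⟩

theorem iterate (hF : IsAutomorphism F) (n : ℕ) : IsAutomorphism F^[n] := by
  induction n with
  | zero => exact ⟨differentiable_id, id, differentiable_id, fun _ => rfl, fun _ => rfl⟩
  | succ n ih => exact ih.comp hF

theorem biholomorphic (hF : IsAutomorphism F) :
    Biholomorphic {x | ‖F x‖ < 1} (unitBall k) := by
  obtain ⟨h, G, hG, hl, hr⟩ := hF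
  refine ⟨isOpen_lt h.continuous.norm continuous_const, Metric.isOpen_ball, F, G,
    h.differentiableOn, hG.differentiableOn, fun x hx => ?_, fun y hy => ?_,
    fun x _ => hl x, fun y _ => hr y⟩
  · simpa [unitBall] using hx
  · simpa [unitBall, hr y] using hy

/-- The homeomorphism underlying an automorphism. -/
theorem exists_homeomorph (hF : IsAutomorphism F) : ∃ e : Cn k ≃ₜ Cn k, ⇑e = F := by
  obtain ⟨h, G, hG, hl, hr⟩ := hF
  exact ⟨⟨⟨F, G, hl, hr⟩, h.continuous, hG.continuous⟩, rfl⟩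

theorem closure_eq (hF : IsAutomorphism F) : closure {x | ‖F x‖ < 1} = {x | ‖F x‖ ≤ 1} := by
  obtain ⟨e, rfl⟩ := hF.exists_homeomorph
  have h1 : {x | ‖e x‖ < 1} = e ⁻¹' Metric.ball 0 1 := by ext; simp
  have h2 : {x | ‖e x‖ ≤ 1} = e ⁻¹' Metric.closedBall 0 1 := by ext; simp
  rw [h1, h2, ← e.preimage_closure, closure_ball _ one_ne_zero]

theorem isCompact_closure (hF : IsAutomorphism F) : IsCompact (closure {x | ‖F x‖ < 1}) := by
  rw [hF.closure_eq]
  obtain ⟨e, rfl⟩ := hF.exists_homeomorph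
  have h2 : {x | ‖e x‖ ≤ 1} = e ⁻¹' Metric.closedBall 0 1 := by ext; simp
  rw [h2, e.isCompact_preimage]
  exact isCompact_closedBall 0 1

end IsAutomorphism

/-! ### Gluing families over unit intervals. -/

/-- The piecewise defined function equal to `φ n (t - n)` for `n ≤ t < n + 1`. -/
noncomputable def glue {α : Type*} (φ : ℕ → ℝ → α) (t : ℝ≥0) : α := φ ⌊t⌋₊ (t - ⌊t⌋₊)

theorem glue_natCast {α : Type*} (φ : ℕ → ℝ → α) (n : ℕ) : glue φ n = φ n 0 := by
  simp [glue]

theorem glue_eq {α : Type*} {φ : ℕ → ℝ → α} (h : ∀ n, φ n 1 = φ (n + 1) 0) {n : ℕ} {t : ℝ≥0}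
    (h1 : (n : ℝ≥0) ≤ t) (h2 : t ≤ n + 1) : glue φ t = φ n (t - n) := by
  rcases h2.eq_or_lt with rfl | h2
  · have := glue_natCast φ (n + 1)
    push_cast at this
    rw [this, ← h]
    simp
  · have : ⌊t⌋₊ = n := (Nat.floor_eq_iff zero_le).2 ⟨h1, h2⟩
    simp [glue, this]

theorem continuous_glue {φ : ℕ → ℝ → ℝ} (h : ∀ n, φ n 1 = φ (n + 1) 0)
    (hc : ∀ n, Continuous (φ n)) : Continuous (glue φ) := by
  have key : ∀ N : ℕ, ContinuousOn (glue φ) (Set.Iic (N : ℝ≥0)) := by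
    intro N
    induction N with
    | zero =>
      have : Set.Iic ((0 : ℕ) : ℝ≥0) = {0} := by ext; simp
      rw [this]
      exact continuousOn_singleton _ _
    | succ N ih =>
      have h1 : ContinuousOn (glue φ) (Set.Icc (N : ℝ≥0) (N + 1)) := by
        refine ContinuousOn.congr (f := fun t : ℝ≥0 => φ N (t - N)) ?_
          fun t ht => glue_eq h ht.1 ht.2
        exact ((hc N).comp (by fun_prop)).continuousOn
      refine (ih.union_of_isClosed h1 isClosed_Iic isClosed_Icc).mono fun t ht => ?_
      simp only [Set.mem_Iic, Nat.cast_add, Nat.cast_one] at ht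
      rcases le_total t N with h | h
      · exact Or.inl h
      · exact Or.inr ⟨h, ht⟩
  rw [continuous_iff_continuousAt]
  intro t
  obtain ⟨N, hN⟩ := exists_nat_gt t
  exact (key N).continuousAt (Iic_mem_nhds hN)

theorem glue_lt_one {φ : ℕ → ℝ → ℝ} (h : ∀ n, φ n 1 = φ (n + 1) 0)
    (hn : ∀ n s s', 0 ≤ s → s < s' → s' ≤ 1 → φ n s ≤ 1 → φ n s' < 1) {t t' : ℝ≥0}
    (htt : t < t') (ht : glue φ t ≤ 1) : glue φ t' < 1 := by
  have key : ∀ N : ℕ, ∀ t t' : ℝ≥0, t < t' → t' ≤ N → glue φ t ≤ 1 → glue φ t' < 1 := by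
    intro N
    induction N with
    | zero =>
      intro t t' h1 h2
      simp only [Nat.cast_zero, nonpos_iff_eq_zero] at h2
      simp [h2] at h1
    | succ N ih =>
      have step : ∀ t t' : ℝ≥0, N ≤ t → t < t' → t' ≤ N + 1 → glue φ t ≤ 1 → glue φ t' < 1 := by
        intro t t' h1 h2 h3 h4
        have h1' : (N : ℝ) ≤ t := by exact_mod_cast h1
        have h2' : (t : ℝ) < t' := by exact_mod_cast h2
        have h3' : (t' : ℝ) ≤ N + 1 := by exact_mod_cast h3
        rw [glue_eq h (h1.trans h2.le) h3]
        rw [glue_eq h h1 (h2.le.trans h3)] at h4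
        exact hn N _ _ (by linarith) (by linarith) (by linarith) h4
      intro t t' h1 h2 h3
      push_cast at h2
      rcases le_or_gt t' N with h4 | h4
      · exact ih t t' h1 h4 h3
      rcases le_or_gt (N : ℝ≥0) t with h5 | h5
      · exact step t t' h5 h1 h2 h3
      · exact step N t' le_rfl h4 h2 (ih t N h5 le_rfl h3).le
  obtain ⟨N, hN⟩ := exists_nat_gt t'
  exact key N t t' htt hN.le ht

/-! ### Loewner families from automorphisms. -/

section Loewner

variable {k : ℕ} {F : ℝ≥0 → Cn k → Cn k} (hF : ∀ t, IsAutomorphism (F t))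
  (hc : ∀ x, Continuous fun t => ‖F t x‖)
  (hn : ∀ t s x, t < s → ‖F t x‖ ≤ 1 → ‖F s x‖ < 1)

include hF hc hn

/-- The closure of a sublevel set is `{‖F t x‖ ≤ 1}`, so `hn` gives the strict nesting; the two
continuity properties come from one-sided limits of `‖F t x‖` in `t`. Continuity is asked of the
norms only, since the maps glued later jump at integers. -/
theorem exists_loewner_family {Ω : Set (Cn k)} (hΩ : Ω = ⋃ t, {x | ‖F t x‖ < 1}) :
    ∃ D : ℝ≥0 → Set (Cn k),
    ((∀ t, Biholomorphic (D t) (unitBall k)) ∨ (∀ t, Biholomorphic (D t) (unitPolydisc k))) ∧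
    Ω = ⋃ t, D t ∧
    (∀ t s, t < s → IsCompact (closure (D t)) ∧ closure (D t) ⊆ D s) ∧
    (∀ t, 0 < t → D t = ⋃ t' ∈ Set.Iio t, D t') ∧
    (∀ t', closure (D t') = ⋂ t ∈ Set.Ioi t', D t) := by
  refine ⟨fun t => {x | ‖F t x‖ < 1}, Or.inl fun t => (hF t).biholomorphic, hΩ,
    fun t s hts => ⟨(hF t).isCompact_closure, ?_⟩, fun t ht => ?_, fun t => ?_⟩
  · rw [(hF t).closure_eq]
    exact fun x hx => hn t s x hts hx
  · refine subset_antisymm (fun x hx => ?_) (fun x hx => ?_)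
    · have h1 : ∀ᶠ t' in 𝓝[<] t, ‖F t' x‖ < 1 :=
        ((hc x).continuousAt.eventually (gt_mem_nhds hx)).filter_mono nhdsWithin_le_nhds
      have : (𝓝[<] t).NeBot := nhdsLT_neBot_of_exists_lt ⟨0, ht⟩
      obtain ⟨t', h1, h2⟩ := (h1.and self_mem_nhdsWithin).exists
      simp only [Set.mem_iUnion]
      exact ⟨t', h2, h1⟩
    · simp only [Set.mem_iUnion] at hx
      obtain ⟨t', h1, h2⟩ := hx
      exact hn t' t x h1 (le_of_lt h2)
  · rw [(hF t).closure_eq]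
    refine subset_antisymm (fun x hx => ?_) (fun x hx => ?_)
    · simp only [Set.mem_iInter]
      exact fun s hs => hn t s x hs hx
    · simp only [Set.mem_iInter] at hx
      refine le_of_tendsto (((hc x).tendsto t).mono_left (nhdsWithin_le_nhds (s := Set.Ioi t))) ?_
      filter_upwards [self_mem_nhdsWithin] with s hs using le_of_lt (hx s hs)

end Loewner

/-! ### Vanishing of the Kobayashi metric. -/

theorem kobayashiMetric_eq_zero_of_tendsto {k : ℕ} {F : ℕ → Cn k → Cn k} {Ω : Set (Cn k)}
    (hF : ∀ n, IsAutomorphism (F n)) (hΩ : ∀ n x, ‖F n x‖ < 1 → x ∈ Ω) {q : Cn k} {η : ℝ}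
    (hη : 0 < η) {ε : ℕ → ℝ} (hε : Filter.Tendsto ε Filter.atTop (𝓝 0))
    (hb : ∀ n, ∀ x ∈ Metric.ball q η, ‖F n x‖ ≤ ε n) (v : Cn k) :
    kobayashiMetric Ω q v = 0 := by
  have key : ∀ α : ℝ, 0 < α → kobayashiMetric Ω q v ≤ ENNReal.ofReal α := by
    intro α hα
    -- The circle `q + ζ v`, `|ζ| = τ`, lies in the ball of radius `η`, so Cauchy's estimate bounds
    -- `D` by `ε n / τ`; the `+ 1` covers `v = 0`.
    set τ : ℝ := η / (2 * (‖v‖ + 1)) with hτ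
    have hv : 0 < ‖v‖ + 1 := by positivity
    have hτ0 : 0 < τ := by positivity
    have hlim : Filter.Tendsto (fun n => ε n + α⁻¹ * (ε n / τ)) Filter.atTop (𝓝 0) := by
      simpa using hε.add ((hε.div_const τ).const_mul α⁻¹)
    obtain ⟨n, hn⟩ := (hlim.eventually (gt_mem_nhds one_pos)).exists
    obtain ⟨hd, G, hG, hl, hr⟩ := hF n
    set D : Cn k := fderiv ℂ (F n) q v with hD
    have hder : HasDerivAt (fun ζ : ℂ => F n (q + ζ • v)) D 0 := by
      have h1 : HasDerivAt (fun ζ : ℂ => q + ζ • v) v 0 := by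
        simpa using ((hasDerivAt_id (0 : ℂ)).smul_const v).const_add q
      have h2 : HasFDerivAt (F n) (fderiv ℂ (F n) q) (q + (0 : ℂ) • v) := by
        simpa using (hd q).hasFDerivAt
      exact h2.comp_hasDerivAt 0 h1
    have hDle : ‖D‖ ≤ ε n / τ := by
      rw [← hder.deriv]
      refine Complex.norm_deriv_le_of_forall_mem_sphere_norm_le hτ0 ?_ fun ζ hζ => ?_
      · apply Differentiable.diffContOnCl
        fun_prop
      · refine hb n _ ?_
        have h1 : ‖ζ‖ = τ := by simpa using hζ
        rw [mem_ball_iff_norm, add_sub_cancel_left, norm_smul, h1, hτ, div_mul_eq_mul_div,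
          div_lt_iff₀ (by positivity)]
        nlinarith [norm_nonneg v]
    have hq : ‖F n q‖ ≤ ε n := hb n q (Metric.mem_ball_self hη)
    -- An affine disc in the unit ball, pulled back by the inverse of `F n`; its direction `D / α`
    -- becomes `v / α` at `q`.
    refine sInf_le ⟨α, fun ζ => G (F n q + ζ • ((α⁻¹ : ℂ) • D)), hα, rfl, ?_, ?_, ?_, ?_⟩
    · apply Differentiable.differentiableOn
      fun_prop
    · intro ζ hζ
      refine hΩ n _ ?_
      rw [hr]
      have h1 : ‖ζ‖ ≤ 1 := by simpa using (mem_ball_zero_iff.1 hζ).le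
      have h2 : ‖ζ • ((α⁻¹ : ℂ) • D)‖ ≤ α⁻¹ * (ε n / τ) := by
        rw [norm_smul, norm_smul, norm_inv, Complex.norm_real, Real.norm_of_nonneg hα.le]
        have : α⁻¹ * ‖D‖ ≤ α⁻¹ * (ε n / τ) := by gcongr
        have h3 : 0 ≤ α⁻¹ * ‖D‖ := by positivity
        nlinarith
      linarith [norm_add_le (F n q) (ζ • ((α⁻¹ : ℂ) • D))]
    · simp [hl q]
    · have h1 : HasDerivAt (fun ζ : ℂ => F n q + ζ • ((α⁻¹ : ℂ) • D)) ((α⁻¹ : ℂ) • D) 0 := by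
        simpa using ((hasDerivAt_id (0 : ℂ)).smul_const ((α⁻¹ : ℂ) • D)).const_add (F n q)
      have h2 : HasFDerivAt G (fderiv ℂ G (F n q)) (F n q + (0 : ℂ) • ((α⁻¹ : ℂ) • D)) := by
        simpa using (hG _).hasFDerivAt
      have h3 : fderiv ℂ G (F n q) D = v := by
        have := (hG (F n q)).hasFDerivAt.comp q (hd q).hasFDerivAt
        have h4 : G ∘ F n = id := funext hl
        rw [h4] at this
        have h5 := this.unique (hasFDerivAt_id q)
        simpa using congrArg (fun T => T v) h5
      have h6 := (h2.comp_hasDerivAt 0 h1).deriv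
      simp only [Function.comp_def] at h6
      rw [h6, map_smul, h3, smul_smul, mul_inv_cancel₀, one_smul]
      exact_mod_cast hα.ne'
  refine le_antisymm (ENNReal.le_of_forall_pos_le_add fun e he _ => ?_) zero_le
  simpa using key e (by exact_mod_cast he)

/-! ### Sub-mean value inequalities and plurisubharmonic limits. -/

open MeasureTheory

/-- Jensen's formula: each zero `u` in the closed disc contributes a nonnegative multiple of `log
(1/|u|) ≥ 0`. -/
theorem log_norm_le_circleAverage {g : ℂ → ℂ} (hg : Differentiable ℂ g) (h0 : g 0 ≠ 0) :
    Real.log ‖g 0‖ ≤ Real.circleAverage (fun z => Real.log ‖g z‖) 0 1 := by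
  have ha : AnalyticOnNhd ℂ g (Metric.closedBall 0 |1|) := fun z _ => hg.analyticAt z
  rw [ha.circleAverage_log_norm one_ne_zero h0]
  refine le_add_of_nonneg_left (finsum_nonneg fun u => ?_)
  by_cases hu : u ∈ Metric.closedBall (0 : ℂ) |1|
  · refine mul_nonneg (mod_cast MeromorphicOn.AnalyticOnNhd.divisor_nonneg ha u) ?_
    rcases eq_or_ne u 0 with rfl | hu0
    · simp
    · refine Real.log_nonneg ?_
      have h1 : ‖u‖ ≤ 1 := by simpa using hu
      simpa using (one_le_inv₀ (norm_pos_iff.2 hu0)).2 h1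
  · rw [Function.locallyFinsuppWithin.apply_eq_zero_of_notMem _ hu]
    simp

/-- `log⁺ ‖f‖` satisfies the sub-mean value inequality for every entire vector-valued `f`. -/
theorem posLog_norm_le_circleAverage {E : Type*} [NormedAddCommGroup E] [NormedSpace ℂ E]
    {f : ℂ → E} (hf : Differentiable ℂ f) :
    Real.posLog ‖f 0‖ ≤ Real.circleAverage (fun z => Real.posLog ‖f z‖) 0 1 := by
  rcases le_or_gt ‖f 0‖ 1 with h1 | h1
  · rw [(Real.posLog_eq_zero_iff _).2 (by simpa using h1)]
    exact Real.circleAverage_nonneg_of_nonneg fun _ _ => Real.posLog_nonneg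
  have h0 : f 0 ≠ 0 := by
    intro h
    norm_num [h] at h1
  -- A functional of norm one attaining `‖f 0‖` reduces the claim to the scalar function `l ∘ f`,
  -- whose modulus is at most `‖f‖`.
  obtain ⟨l, hl, hl0⟩ := exists_dual_vector ℂ (f 0) (norm_ne_zero_iff.2 h0)
  have hg : Differentiable ℂ fun z => l (f z) := l.differentiable.comp hf
  have hn : ‖l (f 0)‖ = ‖f 0‖ := by rw [hl0]; simp
  have h2 := log_norm_le_circleAverage hg (by rw [← norm_ne_zero_iff, hn]; positivity)
  rw [hn] at h2
  rw [Real.posLog_eq_log (by simpa using h1.le)]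
  refine h2.trans (Real.circleAverage_mono ?_ ?_ fun z _ => ?_)
  · refine MeromorphicOn.circleIntegrable_log_norm fun z _ => ?_
    exact (hg.analyticAt z).meromorphicAt
  · apply ContinuousOn.circleIntegrable'
    have := hf.continuous
    exact (Real.continuous_posLog.comp this.norm).continuousOn
  · have h3 : ‖l (f z)‖ ≤ ‖f z‖ := by simpa [hl] using l.le_opNorm (f z)
    exact (le_max_right _ _).trans
      (Real.monotoneOn_posLog (norm_nonneg _) (norm_nonneg _) h3)

theorem ofReal_circleAverage {g : ℂ → ℝ} (hg : Continuous g) (h0 : ∀ z, 0 ≤ g z) :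
    ENNReal.ofReal (Real.circleAverage g 0 1) =
      laverage (volume.restrict (Set.Ioc 0 (2 * Real.pi)))
        fun θ => ENNReal.ofReal (g (circleMap 0 1 θ)) := by
  have hpi : 0 < 2 * Real.pi := by positivity
  have hc : Continuous fun θ => g (circleMap 0 1 θ) := hg.comp (continuous_circleMap 0 1)
  rw [laverage_eq, ← ofReal_integral_eq_lintegral_ofReal, Measure.restrict_apply_univ,
    Real.volume_Ioc, sub_zero, Real.circleAverage_def, intervalIntegral.integral_of_le hpi.le,
    smul_eq_mul, ← ENNReal.ofReal_div_of_pos hpi, div_eq_inv_mul]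
  · exact (hc.integrableOn_Icc).mono_set Set.Ioc_subset_Icc_self
  · exact Filter.Eventually.of_forall fun θ => h0 _

theorem circleMean_of_nonneg {g : ℂ → ℝ} (h0 : ∀ z, 0 ≤ g z) :
    circleMean (fun z => (g z : EReal)) =
      (laverage (volume.restrict (Set.Ioc 0 (2 * Real.pi)))
        fun θ => ENNReal.ofReal (g (circleMap 0 1 θ)) : ℝ≥0∞) := by
  have h1 : ∀ z, ENNReal.ofReal (-g z) = 0 := fun z =>
    ENNReal.ofReal_of_nonpos (neg_nonpos.2 (h0 z))
  simp [circleMean, EReal.toENNReal_of_ne_top, h1]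

/-- Upper semicontinuity holds because `u` is a pointwise infimum of continuous functions; the mean
inequality passes to the limit by dominated convergence with majorant `g 0`. -/
theorem isPlurisubharmonicOn_of_tendsto {k : ℕ} {u : Cn k → ℝ} {g : ℕ → Cn k → ℝ}
    (hg : ∀ n, Continuous (g n)) (hu : ∀ x, 0 ≤ u x) (hug : ∀ n x, u x ≤ g n x)
    (hg0 : ∀ n x, g n x ≤ g 0 x)
    (hlim : ∀ x, Filter.Tendsto (fun n => g n x) Filter.atTop (𝓝 (u x)))
    (hm : ∀ n a b, g n a ≤ Real.circleAverage (fun ζ => g n (a + ζ • b)) 0 1) (Ω : Set (Cn k)) :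
    IsPlurisubharmonicOn (fun x => (u x : EReal)) Ω := by
  refine ⟨fun x _ => EReal.coe_ne_top _, fun x _ y hy => ?_, fun a b _ => ?_⟩
  · obtain ⟨s, hs, hsy⟩ := EReal.lt_iff_exists_real_btwn.1 hy
    obtain ⟨n, hn⟩ := ((hlim x).eventually (gt_mem_nhds (EReal.coe_lt_coe_iff.1 hs))).exists
    have := (hg n).continuousAt.eventually (gt_mem_nhds hn)
    filter_upwards [this.filter_mono nhdsWithin_le_nhds] with x' hx'
    exact lt_trans (EReal.coe_lt_coe_iff.2 ((hug n x').trans_lt hx')) hsy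
  · have hgc : ∀ n, Continuous fun ζ : ℂ => g n (a + ζ • b) := fun n =>
      (hg n).comp (by fun_prop)
    rw [circleMean_of_nonneg fun ζ => hu _]
    have hle : ∀ n, ENNReal.ofReal (u a) ≤
        laverage (volume.restrict (Set.Ioc 0 (2 * Real.pi)))
        fun θ => ENNReal.ofReal (g n (a + circleMap 0 1 θ • b)) := fun n => by
      rw [← ofReal_circleAverage (hgc n) fun ζ => (hu _).trans (hug n _)]
      exact ENNReal.ofReal_le_ofReal ((hug n a).trans (hm n a b))
    have hcont : ∀ n, Continuous fun θ : ℝ => g n (a + circleMap 0 1 θ • b) := fun n =>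
      (hgc n).comp (continuous_circleMap 0 1)
    have hT : Filter.Tendsto (fun n => laverage (volume.restrict (Set.Ioc 0 (2 * Real.pi)))
        fun θ => ENNReal.ofReal (g n (a + circleMap 0 1 θ • b))) Filter.atTop
        (𝓝 (laverage (volume.restrict (Set.Ioc 0 (2 * Real.pi)))
        fun θ => ENNReal.ofReal (u (a + circleMap 0 1 θ • b)))) := by
      simp only [laverage_eq]
      refine ENNReal.Tendsto.div_const ?_ (Or.inr ?_)
      · refine tendsto_lintegral_of_dominated_convergence
          (fun θ => ENNReal.ofReal (g 0 (a + circleMap 0 1 θ • b))) (fun n => ?_) (fun n => ?_)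
          ?_ ?_
        · exact ENNReal.measurable_ofReal.comp (hcont n).measurable
        · exact Filter.Eventually.of_forall fun θ => ENNReal.ofReal_le_ofReal (hg0 n _)
        · rw [← ofReal_integral_eq_lintegral_ofReal]
          · exact ENNReal.ofReal_ne_top
          · exact ((hcont 0).integrableOn_Icc).mono_set Set.Ioc_subset_Icc_self
          · exact Filter.Eventually.of_forall fun θ => (hu _).trans (hug 0 _)
        · exact Filter.Eventually.of_forall fun θ =>
            (ENNReal.continuous_ofReal.tendsto _).comp (hlim _)
      · simp [Real.pi_pos]
    have := ge_of_tendsto' hT hle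
    rw [← EReal.coe_ennreal_le_coe_ennreal_iff, EReal.coe_ennreal_ofReal,
      max_eq_left (hu a)] at this
    exact this

/-! ### Hénon maps and sheared ellipsoids. -/

theorem norm_sq_vec (a b : ℂ) : ‖(!₂[a, b] : Cn 2)‖ ^ 2 = ‖a‖ ^ 2 + ‖b‖ ^ 2 := by
  simp [EuclideanSpace.norm_sq_eq]

theorem norm_vec_le (a b : ℂ) : ‖(!₂[a, b] : Cn 2)‖ ≤ ‖a‖ + ‖b‖ := by
  refine abs_le_of_sq_le_sq' ?_ (by positivity) |>.2
  rw [norm_sq_vec]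
  nlinarith [norm_nonneg a, norm_nonneg b]

theorem differentiable_vec {f g : Cn 2 → ℂ} (hf : Differentiable ℂ f) (hg : Differentiable ℂ g) :
    Differentiable ℂ fun x => (!₂[f x, g x] : Cn 2) := by
  rw [differentiable_euclidean]
  intro i
  fin_cases i
  · simpa using hf
  · simpa using hg

theorem differentiable_apply (i : Fin 2) : Differentiable ℂ fun x : Cn 2 => x i :=
  differentiable_euclidean.1 differentiable_id i

theorem vec_ext {x : Cn 2} {a b : ℂ} (ha : a = x 0) (hb : b = x 1) : !₂[a, b] = x := by
  ext i
  fin_cases i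
  · simpa using ha
  · simpa using hb

/-- The map whose unit sublevel set of the norm is the image of an ellipsoid with semi-axes `B`
and `A` under a shear. -/
noncomputable def shear (q : ℂ[X]) (σ A B : ℝ) (x : Cn 2) : Cn 2 :=
  !₂[x 0 / B, (x 1 + σ * q.eval (x 0)) / A]

theorem isAutomorphism_shear (q : ℂ[X]) (σ : ℝ) {A B : ℝ} (hA : A ≠ 0) (hB : B ≠ 0) :
    IsAutomorphism (shear q σ A B) := by
  have hA' : (A : ℂ) ≠ 0 := mod_cast hA
  have hB' : (B : ℂ) ≠ 0 := mod_cast hB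
  have h0 := differentiable_apply 0
  have h1 := differentiable_apply 1
  refine ⟨differentiable_vec ?_ ?_, fun y => !₂[B * y 0, A * y 1 - σ * q.eval (B * y 0)],
    differentiable_vec ?_ ?_, fun x => vec_ext ?_ ?_, fun y => vec_ext ?_ ?_⟩
  · simpa only [div_eq_mul_inv] using h0.mul_const _
  · simp only [div_eq_mul_inv]
    exact (h1.add ((q.differentiable.comp h0).const_mul _)).mul_const _
  · exact h0.const_mul _
  · exact (h1.const_mul _).sub ((q.differentiable.comp (h0.const_mul _)).const_mul _)
  · simp [shear]
    field_simp
  · simp [shear, mul_div_cancel₀ _ hB', mul_div_cancel₀ _ hA']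
  · simp [hB']
  · simp [hA']

variable {p : ℂ[X]} {δ : ℂ}

theorem isAutomorphism_henon (p : ℂ[X]) (hδ : δ ≠ 0) : IsAutomorphism (henon p δ) := by
  have h0 := differentiable_apply 0
  have h1 := differentiable_apply 1
  refine ⟨differentiable_vec ?_ h0, fun y => !₂[y 1, (y 0 - p.eval (y 1)) / δ],
    differentiable_vec h1 ?_, fun x => vec_ext ?_ ?_, fun y => vec_ext ?_ ?_⟩
  · exact (p.differentiable.comp h0).add (h1.const_mul _)
  · simp only [div_eq_mul_inv]
    exact (h0.sub (p.differentiable.comp h1)).mul_const _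
  · simp [henon]
  · simp [henon, hδ]
  · simp [mul_div_cancel₀ _ hδ]
  · simp

theorem norm_shear_zero (q : ℂ[X]) {A : ℝ} (hA : 0 < A) (x : Cn 2) :
    ‖shear q 0 A A x‖ = ‖x‖ / A := by
  rw [← sq_eq_sq₀ (norm_nonneg _) (by positivity), shear, norm_sq_vec, div_pow,
    EuclideanSpace.norm_sq_eq]
  simp [div_pow, add_div]

/-- The two maps agree up to swapping coordinates and the unimodular factor `δ / |δ|`, which the
norm does not see. -/
theorem norm_shear_one (hδ : δ ≠ 0) {A : ℝ} (hA : 0 < A) (x : Cn 2) :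
    ‖shear (Polynomial.C δ⁻¹ * p) 1 (A / ‖δ‖) A x‖ = ‖henon p δ x‖ / A := by
  have hd : 0 < ‖δ‖ := norm_pos_iff.2 hδ
  rw [← sq_eq_sq₀ (norm_nonneg _) (by positivity), shear, norm_sq_vec, div_pow, henon,
    norm_sq_vec]
  have h : p.eval (x 0) + δ * x 1 = δ * (x 1 + δ⁻¹ * p.eval (x 0)) := by
    field_simp
    ring
  rw [h]
  simp only [Polynomial.eval_mul, Polynomial.eval_C, norm_div, Complex.norm_real, norm_mul,
    Complex.ofReal_one, one_mul, Complex.ofReal_div, Real.norm_of_nonneg hA.le, norm_norm]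
  field_simp
  ring

/-- Strict nesting of two sheared ellipsoids. -/
theorem norm_shear_lt_one {q : ℂ[X]} {σ σ' A A' B B' u : ℝ} (hA : 0 < A) (hA' : 0 < A')
    (hB : 0 < B) (hB' : 0 < B') (hu : 0 < u) (hu1 : u ≤ 1) (hσ : σ ≤ σ')
    (hBB : B * Real.exp u ≤ B') (hAA : A * Real.exp u ≤ A')
    (hq : ∀ z, ‖z‖ ≤ B → (σ' - σ) * ‖q.eval z‖ ≤ A' * (u / 4)) {x : Cn 2}
    (hx : ‖shear q σ A B x‖ ≤ 1) : ‖shear q σ' A' B' x‖ < 1 := by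
  have hx2 : ‖x 0 / B‖ ^ 2 + ‖(x 1 + σ * q.eval (x 0)) / A‖ ^ 2 ≤ 1 := by
    rw [← norm_sq_vec]
    exact pow_le_one₀ (norm_nonneg _) hx
  set y := x 1 + σ * q.eval (x 0) with hy
  have hz : ‖x 0‖ ≤ B := by
    have h1 : ‖x 0 / B‖ ≤ 1 := by
      rw [← sq_le_one_iff₀ (norm_nonneg _)]
      nlinarith [sq_nonneg ‖y / A‖]
    rwa [norm_div, Complex.norm_real, Real.norm_of_nonneg hB.le, div_le_one hB] at h1
  -- The first summand is the old shear with enlarged axes, of norm at most `e^{-u} ≤ 1 - u/2` since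
  -- `u ≤ 1`; the second is the change of shear, of norm at most `u/4`.
  have hsplit : shear q σ' A' B' x =
      !₂[x 0 / B', y / A'] + !₂[0, ((σ' - σ : ℝ) : ℂ) * q.eval (x 0) / A'] := by
    refine vec_ext ?_ ?_
    · simp
    · simp [hy]
      ring
  have he := Real.exp_pos u
  have h1 : ‖(!₂[x 0 / B', y / A'] : Cn 2)‖ ≤ (Real.exp u)⁻¹ := by
    refine abs_le_of_sq_le_sq' ?_ (by positivity) |>.2
    rw [norm_sq_vec]
    simp only [norm_div, Complex.norm_real, Real.norm_of_nonneg hB.le, Real.norm_of_nonneg hA.le,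
      Real.norm_of_nonneg hB'.le, Real.norm_of_nonneg hA'.le] at hx2 ⊢
    have e1 : ‖x 0‖ / B' ≤ (Real.exp u)⁻¹ * (‖x 0‖ / B) := by
      rw [← div_eq_inv_mul, div_div]
      gcongr
    have e2 : ‖y‖ / A' ≤ (Real.exp u)⁻¹ * (‖y‖ / A) := by
      rw [← div_eq_inv_mul, div_div]
      gcongr
    calc (‖x 0‖ / B') ^ 2 + (‖y‖ / A') ^ 2
        ≤ ((Real.exp u)⁻¹ * (‖x 0‖ / B)) ^ 2 + ((Real.exp u)⁻¹ * (‖y‖ / A)) ^ 2 := by gcongr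
      _ = (Real.exp u)⁻¹ ^ 2 * ((‖x 0‖ / B) ^ 2 + (‖y‖ / A) ^ 2) := by ring
      _ ≤ (Real.exp u)⁻¹ ^ 2 * 1 := by gcongr
      _ = _ := mul_one _
  have h2 : ‖(!₂[0, ((σ' - σ : ℝ) : ℂ) * q.eval (x 0) / A'] : Cn 2)‖ ≤ u / 4 := by
    refine (norm_vec_le _ _).trans ?_
    rw [norm_zero, zero_add, norm_div, norm_mul, Complex.norm_real, Complex.norm_real,
      Real.norm_of_nonneg hA'.le, Real.norm_of_nonneg (sub_nonneg.2 hσ), div_le_iff₀ hA',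
      mul_comm (u / 4)]
    exact hq _ hz
  have h3 : (Real.exp u)⁻¹ ≤ 1 - u / 2 := by
    have h4 : 1 + u ≤ Real.exp u := by linarith [Real.add_one_le_exp u]
    refine (inv_anti₀ (by positivity) h4).trans ?_
    rw [inv_le_iff_one_le_mul₀ (by positivity)]
    nlinarith
  rw [hsplit]
  refine (norm_add_le _ _).trans_lt ?_
  linarith

/-! ### Interpolation between a ball and its successor. -/

/-- Clamping to the unit interval. -/
noncomputable def clamp (s : ℝ) : ℝ := max 0 (min 1 s)

theorem continuous_clamp : Continuous clamp := by
  unfold clamp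
  fun_prop

theorem clamp_mono : Monotone clamp := fun _ _ h => max_le_max le_rfl (min_le_min le_rfl h)

theorem clamp_of_nonpos {s : ℝ} (h : s ≤ 0) : clamp s = 0 := by
  rw [clamp, max_eq_left]
  exact (min_le_right _ _).trans h

theorem clamp_of_one_le {s : ℝ} (h : 1 ≤ s) : clamp s = 1 := by
  rw [clamp, min_eq_left h, max_eq_right zero_le_one]

theorem clamp_sub_le {s s' : ℝ} (h : s ≤ s') : clamp s' - clamp s ≤ s' - s := by
  unfold clamp
  rcases max_cases 0 (min 1 s) with ⟨h1, h2⟩ | ⟨h1, h2⟩ <;>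
  rcases max_cases 0 (min 1 s') with ⟨h3, h4⟩ | ⟨h3, h4⟩ <;>
  rcases min_cases 1 s with ⟨h5, h6⟩ | ⟨h5, h6⟩ <;>
  rcases min_cases 1 s' with ⟨h7, h8⟩ | ⟨h7, h8⟩ <;> linarith

/-- A family of automorphisms whose unit sublevel sets interpolate between the ball of radius
`exp L` and the preimage of the ball of radius `exp L'` under the Hénon map: first the second
semi-axis grows, then the shear is performed, then the first semi-axis grows. -/
noncomputable def interpolation (p : ℂ[X]) (δ : ℂ) (L L' s : ℝ) : Cn 2 → Cn 2 :=
  shear (Polynomial.C δ⁻¹ * p) (clamp (3 * s - 1))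
    -- The summand `s` keeps both axes growing at all times; the `- 1` compensates for it, so that
    -- the values at `s = 1` are exact.
    (Real.exp (L + s + (L' - Real.log ‖δ‖ - L - 1) * clamp (3 * s)))
    (Real.exp (L + s + (L' - L - 1) * clamp (3 * s - 2)))

theorem isAutomorphism_interpolation (p : ℂ[X]) (δ : ℂ) (L L' s : ℝ) :
    IsAutomorphism (interpolation p δ L L' s) :=
  isAutomorphism_shear _ _ (Real.exp_pos _).ne' (Real.exp_pos _).ne'

theorem continuous_norm_interpolation (p : ℂ[X]) (δ : ℂ) (L L' : ℝ) (x : Cn 2) :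
    Continuous fun s => ‖interpolation p δ L L' s x‖ := by
  have h1 : Continuous fun s => clamp (3 * s - 1) := continuous_clamp.comp (by fun_prop)
  have h2 : Continuous fun s => clamp (3 * s - 2) := continuous_clamp.comp (by fun_prop)
  have h3 : Continuous fun s => clamp (3 * s) := continuous_clamp.comp (by fun_prop)
  have h4 : Continuous fun s => (clamp (3 * s - 1) : ℂ) := Complex.continuous_ofReal.comp h1
  simp only [interpolation, shear, EuclideanSpace.norm_eq, Fin.sum_univ_two]
  refine Real.continuous_sqrt.comp ((Continuous.pow ?_ 2).add (Continuous.pow ?_ 2))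
  · refine (Continuous.div continuous_const (Complex.continuous_ofReal.comp ?_)
      fun s => Complex.ofReal_ne_zero.2 (Real.exp_pos _).ne').norm
    fun_prop
  · refine (Continuous.div ?_ (Complex.continuous_ofReal.comp ?_)
      fun s => Complex.ofReal_ne_zero.2 (Real.exp_pos _).ne').norm
    · fun_prop
    · fun_prop

theorem norm_interpolation_zero (p : ℂ[X]) (δ : ℂ) (L L' : ℝ) (x : Cn 2) :
    ‖interpolation p δ L L' 0 x‖ = ‖x‖ / Real.exp L := by
  have h1 : clamp (3 * 0 - 1) = 0 := clamp_of_nonpos (by norm_num)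
  have h2 : clamp (3 * 0 - 2) = 0 := clamp_of_nonpos (by norm_num)
  have h3 : clamp (3 * 0) = 0 := clamp_of_nonpos (by norm_num)
  rw [interpolation, h1, h2, h3]
  simpa using norm_shear_zero (Polynomial.C δ⁻¹ * p) (Real.exp_pos L) x

theorem norm_interpolation_one (p : ℂ[X]) (hδ : δ ≠ 0) (L L' : ℝ) (x : Cn 2) :
    ‖interpolation p δ L L' 1 x‖ = ‖henon p δ x‖ / Real.exp L' := by
  have h1 : clamp (3 * 1 - 1) = 1 := clamp_of_one_le (by norm_num)
  have h2 : clamp (3 * 1 - 2) = 1 := clamp_of_one_le (by norm_num)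
  have h3 : clamp (3 * 1) = 1 := clamp_of_one_le (by norm_num)
  have h4 : L + 1 + (L' - Real.log ‖δ‖ - L - 1) * 1 = L' - Real.log ‖δ‖ := by ring
  have h5 : L + 1 + (L' - L - 1) * 1 = L' := by ring
  rw [interpolation, h1, h2, h3, h4, h5, Real.exp_sub, Real.exp_log (norm_pos_iff.2 hδ)]
  exact norm_shear_one hδ (Real.exp_pos L') x

theorem norm_interpolation_lt_one {C k L s s' : ℝ} (hδ : δ ≠ 0)
    (hp : 2 ≤ p.natDegree) (hC : ∀ z, ‖p.eval z‖ ≤ C * max 1 ‖z‖ ^ p.natDegree)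
    (hk1 : 1 ≤ k) (hk2 : 1 + Real.log ‖δ‖ ≤ k)
    (hk3 : 12 * C * Real.exp (p.natDegree + 1) ≤ Real.exp k) (hL : 0 ≤ L)
    (hs : 0 ≤ s) (hss : s < s') (hs' : s' ≤ 1) {x : Cn 2}
    (hx : ‖interpolation p δ L (p.natDegree * L + k) s x‖ ≤ 1) :
    ‖interpolation p δ L (p.natDegree * L + k) s' x‖ < 1 := by
  set d := p.natDegree with hd
  have hd2 : (2 : ℝ) ≤ d := by exact_mod_cast hp
  have hdL : 2 * L ≤ d * L := by gcongr
  have hC0 : 0 ≤ C := by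
    have := (norm_nonneg _).trans (hC 0)
    simpa using this
  have hδ0 : 0 < ‖δ‖ := norm_pos_iff.2 hδ
  refine norm_shear_lt_one (u := s' - s) (Real.exp_pos _) (Real.exp_pos _) (Real.exp_pos _)
    (Real.exp_pos _) (by linarith) (by linarith) (clamp_mono (by linarith)) ?_ ?_ ?_ hx
  · rw [← Real.exp_add, Real.exp_le_exp]
    have h1 : (d * L + k - L - 1) * clamp (3 * s - 2) ≤ (d * L + k - L - 1) * clamp (3 * s' - 2) :=
      mul_le_mul_of_nonneg_left (clamp_mono (by linarith)) (by linarith)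
    linarith
  · rw [← Real.exp_add, Real.exp_le_exp]
    have h1 : (d * L + k - Real.log ‖δ‖ - L - 1) * clamp (3 * s) ≤
        (d * L + k - Real.log ‖δ‖ - L - 1) * clamp (3 * s') :=
      mul_le_mul_of_nonneg_left (clamp_mono (by linarith)) (by linarith)
    linarith
  · intro z hz
    have hu : 0 < s' - s := by linarith
    -- Outside this case the shear parameter does not change. Inside it, the first axis at `s` is
    -- still at most `e^(L+1)` while the second at `s'` is already at least `e^(dL+k-1) / |δ|`.
    by_cases h : s < 2 / 3 ∧ 1 / 3 < s'
    · have h1 : clamp (3 * s - 2) = 0 := clamp_of_nonpos (by linarith)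
      have h2 : clamp (3 * s') = 1 := clamp_of_one_le (by linarith)
      have h3 : clamp (3 * s' - 1) - clamp (3 * s - 1) ≤ 3 * (s' - s) :=
        (clamp_sub_le (by linarith)).trans_eq (by ring)
      rw [h1] at hz
      rw [h2]
      have hz1 : max 1 ‖z‖ ≤ Real.exp (L + 1) := by
        refine max_le ?_ (hz.trans (Real.exp_le_exp.2 (by linarith)))
        exact Real.one_le_exp (by linarith)
      have hz2 : ‖p.eval z‖ ≤ C * Real.exp (d * (L + 1)) := by
        refine (hC z).trans ?_
        rw [Real.exp_nat_mul]
        gcongr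
      have hq : ‖(Polynomial.C δ⁻¹ * p).eval z‖ ≤ ‖δ‖⁻¹ * (C * Real.exp (d * (L + 1))) := by
        rw [Polynomial.eval_mul, Polynomial.eval_C, norm_mul, norm_inv]
        gcongr
      have hA : ‖δ‖⁻¹ * Real.exp (d * L + k - 1) ≤
          Real.exp (L + s' + (d * L + k - Real.log ‖δ‖ - L - 1) * 1) := by
        have : Real.exp (d * L + k - 1 - Real.log ‖δ‖) = ‖δ‖⁻¹ * Real.exp (d * L + k - 1) := by
          rw [Real.exp_sub, Real.exp_log hδ0, div_eq_inv_mul]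
        rw [← this, Real.exp_le_exp]
        linarith
      -- Here `12 = 3 · 4`: the shear parameter has slope at most `3`, and a quarter of `s' - s` is
      -- available.
      have hkey : 12 * (C * Real.exp (d * (L + 1))) ≤ Real.exp (d * L + k - 1) := by
        have e1 : Real.exp (d * (L + 1)) = Real.exp (d + 1) * Real.exp (d * L - 1) := by
          rw [← Real.exp_add]
          ring_nf
        have e2 : Real.exp (d * L + k - 1) = Real.exp k * Real.exp (d * L - 1) := by
          rw [← Real.exp_add]
          ring_nf
        rw [e1, e2]
        have := mul_le_mul_of_nonneg_right hk3 (Real.exp_pos (d * L - 1)).le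
        linarith
      calc _ ≤ 3 * (s' - s) * (‖δ‖⁻¹ * (C * Real.exp (d * (L + 1)))) := by
            gcongr
        _ = ‖δ‖⁻¹ * (12 * (C * Real.exp (d * (L + 1)))) * ((s' - s) / 4) := by ring
        _ ≤ ‖δ‖⁻¹ * Real.exp (d * L + k - 1) * ((s' - s) / 4) := by gcongr
        _ ≤ _ := by gcongr
    · have h1 : clamp (3 * s' - 1) - clamp (3 * s - 1) = 0 := by
        rw [not_and_or, not_lt, not_lt] at h
        rcases h with h | h
        · rw [clamp_of_one_le, clamp_of_one_le] <;> linarith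
        · rw [clamp_of_nonpos, clamp_of_nonpos] <;> linarith
      rw [h1, zero_mul]
      positivity

/-! ### Growth estimates and the Green function. -/

open Filter

theorem exists_norm_eval_le (p : ℂ[X]) :
    ∃ C : ℝ, 0 ≤ C ∧ ∀ z, ‖p.eval z‖ ≤ C * max 1 ‖z‖ ^ p.natDegree := by
  refine ⟨∑ i ∈ Finset.range (p.natDegree + 1), ‖p.coeff i‖,
    Finset.sum_nonneg fun _ _ => norm_nonneg _, fun z => ?_⟩
  rw [Polynomial.eval_eq_sum_range, Finset.sum_mul]
  refine (norm_sum_le _ _).trans (Finset.sum_le_sum fun i hi => ?_)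
  rw [norm_mul, norm_pow]
  gcongr
  calc ‖z‖ ^ i ≤ max 1 ‖z‖ ^ i := by gcongr; exact le_max_right _ _
    _ ≤ _ := pow_le_pow_right₀ (le_max_left _ _) (by simpa [Nat.lt_succ_iff] using hi)

/-- Write `p(z) = z^d p*(1/z)` with `p*` the reversed polynomial; `p*(0)` is the leading
coefficient, so `|p*|` stays above half its modulus near `0`. -/
theorem exists_le_norm_eval {p : ℂ[X]} (hp : p ≠ 0) :
    ∃ c R : ℝ, 0 < c ∧ ∀ z, R ≤ ‖z‖ → c * ‖z‖ ^ p.natDegree ≤ ‖p.eval z‖ := by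
  have h0 : 0 < ‖p.reverse.eval 0‖ := by
    rw [← Polynomial.coeff_zero_eq_eval_zero, Polynomial.coeff_zero_reverse]
    exact norm_pos_iff.2 (Polynomial.leadingCoeff_ne_zero.2 hp)
  have hc := (p.reverse.continuous.norm.tendsto 0).eventually (lt_mem_nhds (half_lt_self h0))
  obtain ⟨ε, hε, h⟩ := Metric.eventually_nhds_iff.1 hc
  refine ⟨_, 2 * ε⁻¹, half_pos h0, fun z hz => ?_⟩
  have hεi : 0 < ε⁻¹ := inv_pos.2 hε
  have hz0 : 0 < ‖z‖ := by linarith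
  have := invertibleOfNonzero (norm_pos_iff.1 hz0)
  have h1 : p.reverse.eval z⁻¹ * z ^ p.natDegree = p.eval z := by
    have := Polynomial.eval₂_reverse_mul_pow (RingHom.id ℂ) z p
    rwa [invOf_eq_inv] at this
  rw [← h1, norm_mul, norm_pow]
  gcongr
  refine (h ?_).le
  rw [dist_zero_right, norm_inv, inv_lt_comm₀ hz0 hε]
  linarith

theorem exists_norm_henon_le (p : ℂ[X]) (δ : ℂ) :
    ∃ C : ℝ, 0 ≤ C ∧ ∀ x, 1 ≤ p.natDegree →
      ‖henon p δ x‖ ≤ C * max 1 ‖x‖ ^ p.natDegree := by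
  obtain ⟨C, hC0, hC⟩ := exists_norm_eval_le p
  refine ⟨C + ‖δ‖ + 1, by positivity, fun x hp => ?_⟩
  have h1 : (1 : ℝ) ≤ max 1 ‖x‖ := le_max_left _ _
  have h2 : ∀ i, ‖x i‖ ≤ max 1 ‖x‖ := fun i => (PiLp.norm_apply_le x i).trans (le_max_right _ _)
  have h3 : max 1 ‖x‖ ≤ max 1 ‖x‖ ^ p.natDegree := le_self_pow₀ h1 (by lia)
  have h4 : ‖p.eval (x 0)‖ ≤ C * max 1 ‖x‖ ^ p.natDegree := by
    refine (hC _).trans ?_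
    gcongr
    exact PiLp.norm_apply_le x 0
  calc ‖henon p δ x‖ ≤ ‖p.eval (x 0) + δ * x 1‖ + ‖x 0‖ := norm_vec_le _ _
    _ ≤ ‖p.eval (x 0)‖ + ‖δ‖ * ‖x 1‖ + ‖x 0‖ := by
      gcongr
      exact (norm_add_le _ _).trans_eq (by rw [norm_mul])
    _ ≤ C * max 1 ‖x‖ ^ p.natDegree + ‖δ‖ * max 1 ‖x‖ ^ p.natDegree
        + max 1 ‖x‖ ^ p.natDegree := by
      gcongr
      · exact (h2 1).trans h3
      · exact (h2 0).trans h3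
    _ = _ := by ring

variable {p : ℂ[X]} {δ : ℂ}

/-- The approximants `d^{-n} (log⁺ ‖H^n‖ + c)` of the Green function; they decrease if `c` is
suitably chosen. -/
noncomputable def greenApprox (p : ℂ[X]) (δ : ℂ) (c : ℝ) (n : ℕ) (x : Cn 2) : ℝ :=
  (Real.posLog ‖(henon p δ)^[n] x‖ + c) / (p.natDegree : ℝ) ^ n

theorem differentiable_iterate_henon (p : ℂ[X]) (δ : ℂ) (n : ℕ) :
    Differentiable ℂ (henon p δ)^[n] := by
  have h0 := differentiable_apply 0
  have h1 := differentiable_apply 1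
  exact Differentiable.iterate
    (differentiable_vec ((p.differentiable.comp h0).add (h1.const_mul _)) h0) n

theorem continuous_greenApprox (p : ℂ[X]) (δ : ℂ) (c : ℝ) (n : ℕ) :
    Continuous (greenApprox p δ c n) :=
  ((Real.continuous_posLog.comp
    (differentiable_iterate_henon p δ n).continuous.norm).add continuous_const).div_const _

theorem greenApprox_nonneg {c : ℝ} (hc : 0 ≤ c) (n : ℕ) (x : Cn 2) :
    0 ≤ greenApprox p δ c n x :=
  div_nonneg (add_nonneg Real.posLog_nonneg hc) (by positivity)

theorem greenApprox_le_circleAverage (c : ℝ) (n : ℕ) (a b : Cn 2) :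
    greenApprox p δ c n a ≤
      Real.circleAverage (fun ζ => greenApprox p δ c n (a + ζ • b)) 0 1 := by
  have hd : Differentiable ℂ fun ζ : ℂ => (henon p δ)^[n] (a + ζ • b) :=
    (differentiable_iterate_henon p δ n).comp (by fun_prop)
  have hc : Continuous fun ζ : ℂ => Real.posLog ‖(henon p δ)^[n] (a + ζ • b)‖ :=
    Real.continuous_posLog.comp hd.continuous.norm
  have h := posLog_norm_le_circleAverage hd
  simp only [zero_smul, add_zero] at h
  have h2 : Real.circleAverage (fun ζ => greenApprox p δ c n (a + ζ • b)) 0 1 =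
      ((p.natDegree : ℝ) ^ n)⁻¹ *
        (Real.circleAverage (fun ζ : ℂ => Real.posLog ‖(henon p δ)^[n] (a + ζ • b)‖) 0 1 + c) := by
    simp only [greenApprox, div_eq_inv_mul]
    conv_rhs => rw [← Real.circleAverage_const c 0 1]
    rw [← Real.circleAverage_fun_add, ← smul_eq_mul, ← Real.circleAverage_fun_smul]
    · simp only [smul_eq_mul]
    · exact hc.continuousOn.circleIntegrable'
    · exact continuousOn_const.circleIntegrable'
  rw [h2, greenApprox, div_eq_inv_mul]
  gcongr

section Decreasing

variable {k c : ℝ} (hp : 2 ≤ p.natDegree) (hk0 : 0 ≤ k)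
  (hk : ∀ x, ‖henon p δ x‖ ≤ Real.exp k * max 1 ‖x‖ ^ p.natDegree)
  (hc : c * (p.natDegree - 1) = k)

include hp hk0 hk hc

/-- One step costs `log⁺ ‖H y‖ ≤ k + d log⁺ ‖y‖`, and `k + c = d c` absorbs the constant. -/
theorem antitone_greenApprox (x : Cn 2) : Antitone fun n => greenApprox p δ c n x := by
  refine antitone_nat_of_succ_le fun n => ?_
  have hd : (0 : ℝ) < p.natDegree := by exact_mod_cast (by lia : 0 < p.natDegree)
  rw [greenApprox, greenApprox, pow_succ', ← div_div, Function.iterate_succ_apply']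
  set y := (henon p δ)^[n] x
  gcongr
  rw [div_le_iff₀ hd, Real.posLog_eq_log_max_one (norm_nonneg _),
    Real.posLog_eq_log_max_one (norm_nonneg _)]
  have h1 : (1 : ℝ) ≤ max 1 ‖y‖ := le_max_left _ _
  have h2 : Real.log (max 1 ‖henon p δ y‖) ≤ k + p.natDegree * Real.log (max 1 ‖y‖) := by
    rw [← Real.log_pow, ← Real.log_exp k, ← Real.log_mul (Real.exp_pos _).ne' (by positivity)]
    refine Real.log_le_log (by positivity) (max_le ?_ (hk y))
    exact one_le_mul_of_one_le_of_one_le (Real.one_le_exp hk0) (one_le_pow₀ h1)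
  linarith

theorem tendsto_green (x : Cn 2) :
    Tendsto (greenSeq p δ x) atTop (𝓝 (green p δ x)) ∧
      Tendsto (fun n => greenApprox p δ c n x) atTop (𝓝 (green p δ x)) := by
  have hd2 : (2 : ℝ) ≤ p.natDegree := by exact_mod_cast hp
  have hc0 : 0 ≤ c := by
    by_contra! h
    nlinarith
  have h1 := tendsto_atTop_ciInf (antitone_greenApprox hp hk0 hk hc x)
    ⟨0, by rintro _ ⟨n, rfl⟩; exact greenApprox_nonneg hc0 n x⟩
  have h2 : Tendsto (fun n : ℕ => c * ((p.natDegree : ℝ)⁻¹) ^ n) atTop (𝓝 0) := by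
    simpa using (tendsto_pow_atTop_nhds_zero_of_lt_one (by positivity)
      (inv_lt_one_of_one_lt₀ (by linarith))).const_mul c
  have h3 := h1.sub h2
  have h4 : (fun n => greenApprox p δ c n x - c * ((p.natDegree : ℝ)⁻¹) ^ n) =
      greenSeq p δ x := by
    ext n
    rw [greenApprox, greenSeq, inv_pow]
    ring
  rw [h4, sub_zero] at h3
  have h5 : green p δ x = ⨅ n, greenApprox p δ c n x := h3.limUnder_eq
  rw [h5]
  exact ⟨h3, h1⟩

theorem green_le_greenApprox (n : ℕ) (x : Cn 2) : green p δ x ≤ greenApprox p δ c n x :=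
  (antitone_greenApprox hp hk0 hk hc x).le_of_tendsto (tendsto_green hp hk0 hk hc x).2 n

theorem green_nonneg (x : Cn 2) : 0 ≤ green p δ x :=
  ge_of_tendsto' (tendsto_green hp hk0 hk hc x).1 fun n => by
    have := Real.posLog_nonneg (x := ‖(henon p δ)^[n] x‖)
    rw [greenSeq]
    positivity

theorem green_henon (x : Cn 2) : green p δ (henon p δ x) = p.natDegree * green p δ x := by
  have h1 := (tendsto_green hp hk0 hk hc (henon p δ x)).1
  have h2 := ((tendsto_add_atTop_iff_nat 1).2
    (tendsto_green hp hk0 hk hc x).1).const_mul (p.natDegree : ℝ)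
  refine tendsto_nhds_unique h1 (h2.congr fun n => ?_)
  have hd : (0 : ℝ) < p.natDegree := by exact_mod_cast (by lia : 0 < p.natDegree)
  rw [greenSeq, greenSeq, Function.iterate_succ_apply, pow_succ]
  field_simp

theorem isPlurisubharmonicOn_green (Ω : Set (Cn 2)) :
    IsPlurisubharmonicOn (fun x => (green p δ x : EReal)) Ω :=
  isPlurisubharmonicOn_of_tendsto (continuous_greenApprox p δ c) (green_nonneg hp hk0 hk hc)
    (green_le_greenApprox hp hk0 hk hc)
    (fun n x => antitone_greenApprox hp hk0 hk hc x (Nat.zero_le n))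
    (fun x => (tendsto_green hp hk0 hk hc x).2) (greenApprox_le_circleAverage c) Ω

theorem exists_green_pos : ∃ x, 0 < green p δ x := by
  obtain ⟨c', R, hc', hR⟩ := exists_le_norm_eval (p := p) (by rintro rfl; simp at hp)
  set d := p.natDegree with hd
  -- On the region `‖x 1‖ ≤ ‖x 0‖`, `‖x 0‖ ≥ R'`, half of `|p|` absorbs `δ w`. The factor `b`
  -- normalizes the first coordinate so that `b ‖x 0‖` starts at `2` or more and is at least raised
  -- to the power `d` at each step.
  set b := min (c' / 2) 1 with hb
  have hb0 : 0 < b := lt_min (by positivity) one_pos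
  have hb1 : b ≤ 1 := min_le_right _ _
  have hbc : b ≤ c' / 2 := min_le_left _ _
  set R' := max (max R 1) (max (2 / b) (2 * ‖δ‖ / c')) with hR'
  have hR1 : R ≤ R' := (le_max_left _ _).trans (le_max_left _ _)
  have hR2 : 1 ≤ R' := (le_max_right _ _).trans (le_max_left _ _)
  have hR3 : 2 / b ≤ R' := (le_max_left _ _).trans (le_max_right _ _)
  have hR4 : 2 * ‖δ‖ / c' ≤ R' := (le_max_right _ _).trans (le_max_right _ _)
  have step : ∀ x : Cn 2, R' ≤ ‖x 0‖ → ‖x 1‖ ≤ ‖x 0‖ →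
      (b * ‖x 0‖) ^ d ≤ b * ‖henon p δ x 0‖ ∧ ‖x 0‖ ≤ ‖henon p δ x 0‖ ∧
        ‖henon p δ x 1‖ = ‖x 0‖ := by
    intro x h0 h1
    set t := ‖x 0‖ with ht
    have e1 : 2 ≤ b * t := by
      have := hR3.trans h0
      rwa [div_le_iff₀ hb0, mul_comm] at this
    have e2 : 2 * ‖δ‖ ≤ c' * t := by
      have := hR4.trans h0
      rwa [div_le_iff₀ hc', mul_comm t] at this
    have ht1 : 1 ≤ t := hR2.trans h0
    have e3 : 2 * (‖δ‖ * t) ≤ c' * t ^ d := by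
      have : t ^ 2 ≤ t ^ d := pow_le_pow_right₀ ht1 hp
      nlinarith
    have e4 : c' * t ^ d ≤ ‖p.eval (x 0)‖ := hR _ (hR1.trans h0)
    have e5 : ‖p.eval (x 0)‖ ≤ ‖henon p δ x 0‖ + ‖δ‖ * t := by
      have : p.eval (x 0) = henon p δ x 0 - δ * x 1 := by simp [henon]
      rw [this]
      refine (norm_sub_le _ _).trans ?_
      rw [norm_mul]
      gcongr
    have e6 : b * t ^ d ≤ ‖henon p δ x 0‖ := by
      have : b * t ^ d ≤ c' / 2 * t ^ d := by gcongr
      linarith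
    have e7 : (b * t) ^ d ≤ b * ‖henon p δ x 0‖ := by
      have h2 : b ^ d ≤ b ^ 2 := pow_le_pow_of_le_one hb0.le hb1 hp
      calc (b * t) ^ d = b ^ d * t ^ d := mul_pow _ _ _
        _ ≤ b ^ 2 * t ^ d := by gcongr
        _ = b * (b * t ^ d) := by ring
        _ ≤ _ := by gcongr
    refine ⟨e7, ?_, by simp [henon, ht]⟩
    have e8 : b * t ≤ (b * t) ^ d := le_self_pow₀ (by linarith) (by lia)
    exact le_of_mul_le_mul_left (e8.trans e7) hb0
  set x₀ : Cn 2 := !₂[(R' : ℂ), 0] with hx₀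
  have hx0 : ‖x₀ 0‖ = R' := by
    simp [hx₀, abs_of_nonneg (zero_le_one.trans hR2)]
  have grow : ∀ n, R' ≤ ‖(henon p δ)^[n] x₀ 0‖ ∧
      ‖(henon p δ)^[n] x₀ 1‖ ≤ ‖(henon p δ)^[n] x₀ 0‖ ∧
      2 ^ d ^ n ≤ b * ‖(henon p δ)^[n] x₀ 0‖ := by
    intro n
    induction n with
    | zero =>
      simp only [Function.iterate_zero, id_eq, hx0, pow_zero, pow_one]
      refine ⟨le_rfl, by simp [hx₀]; linarith, ?_⟩
      rwa [div_le_iff₀ hb0, mul_comm] at hR3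
    | succ n ih =>
      obtain ⟨h1, h2, h3⟩ := ih
      obtain ⟨g1, g2, g3⟩ := step _ h1 h2
      rw [Function.iterate_succ_apply']
      refine ⟨h1.trans g2, g3.trans_le g2, le_trans ?_ g1⟩
      rw [pow_succ, pow_mul]
      gcongr
  refine ⟨x₀, (Real.log_pos one_lt_two).trans_le
    (ge_of_tendsto' (tendsto_green hp hk0 hk hc x₀).1 fun n => ?_)⟩
  obtain ⟨-, -, h3⟩ := grow n
  have hdpos : (0 : ℝ) < d := by exact_mod_cast (by lia : 0 < d)
  have h4 : (2 : ℝ) ^ d ^ n ≤ ‖(henon p δ)^[n] x₀‖ :=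
    h3.trans ((mul_le_of_le_one_left (norm_nonneg _) hb1).trans (PiLp.norm_apply_le _ 0))
  have h5 : (d : ℝ) ^ n * Real.log 2 ≤ Real.posLog ‖(henon p δ)^[n] x₀‖ := by
    have h6 : Real.log ((2 : ℝ) ^ d ^ n) = (d : ℝ) ^ n * Real.log 2 := by
      rw [Real.log_pow]
      push_cast
      rfl
    rw [← h6]
    exact (Real.log_le_log (by positivity) h4).trans (le_max_right _ _)
  rw [greenSeq, one_div, ← div_eq_inv_mul, le_div_iff₀ (by positivity)]
  linarith

end Decreasing

theorem exists_growth_constants (p : ℂ[X]) (hp : 2 ≤ p.natDegree) (δ : ℂ) :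
    ∃ C k c : ℝ, (∀ z, ‖p.eval z‖ ≤ C * max 1 ‖z‖ ^ p.natDegree) ∧ 1 ≤ k ∧
      1 + Real.log ‖δ‖ ≤ k ∧ 12 * C * Real.exp (p.natDegree + 1) ≤ Real.exp k ∧
      (∀ x, ‖henon p δ x‖ ≤ Real.exp k * max 1 ‖x‖ ^ p.natDegree) ∧
      c * (p.natDegree - 1) = k := by
  obtain ⟨C, -, hC⟩ := exists_norm_eval_le p
  obtain ⟨C', -, hC'⟩ := exists_norm_henon_le p δ
  have h1 : ∀ᶠ k : ℝ in atTop, 1 ≤ k := eventually_ge_atTop 1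
  have h2 : ∀ᶠ k : ℝ in atTop, 1 + Real.log ‖δ‖ ≤ k := eventually_ge_atTop _
  have h3 : ∀ᶠ k : ℝ in atTop, 12 * C * Real.exp (p.natDegree + 1) ≤ Real.exp k :=
    Real.tendsto_exp_atTop.eventually_ge_atTop _
  have h4 : ∀ᶠ k : ℝ in atTop, C' ≤ Real.exp k := Real.tendsto_exp_atTop.eventually_ge_atTop _
  obtain ⟨k, g1, g2, g3, g4⟩ := (h1.and (h2.and (h3.and h4))).exists
  refine ⟨C, k, k / (p.natDegree - 1), hC, g1, g2, g3, fun x => ?_, ?_⟩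
  · refine (hC' x (by lia)).trans ?_
    gcongr
  · have hd2 : (2 : ℝ) ≤ p.natDegree := by exact_mod_cast hp
    exact div_mul_cancel₀ _ (by linarith)

theorem posLog_norm_lt_iff {E : Type*} [NormedAddCommGroup E] {L : ℝ} (hL : 0 < L) (y : E) :
    Real.posLog ‖y‖ < L ↔ ‖y‖ < Real.exp L := by
  rw [Real.posLog_eq_log_max_one (norm_nonneg _), Real.log_lt_iff_lt_exp (by positivity),
    max_lt_iff]
  exact and_iff_right (Real.one_lt_exp_iff.2 hL)

/-! ### Sublevel sets of the Green function. -/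

section Sublevel

variable {p : ℂ[X]} {δ : ℂ} {C k c r : ℝ} {N : ℕ} (hδ : δ ≠ 0) (hp : 2 ≤ p.natDegree)
  (hC : ∀ z, ‖p.eval z‖ ≤ C * max 1 ‖z‖ ^ p.natDegree)
  (hk1 : 1 ≤ k) (hk2 : 1 + Real.log ‖δ‖ ≤ k)
  (hk3 : 12 * C * Real.exp (p.natDegree + 1) ≤ Real.exp k)
  (hk : ∀ x, ‖henon p δ x‖ ≤ Real.exp k * max 1 ‖x‖ ^ p.natDegree)
  (hc : c * (p.natDegree - 1) = k) (hr : 0 < r) (hN : c < (p.natDegree : ℝ) ^ N * r)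

/-- The logarithm of the radius of the ball whose preimage under the `(N + n)`-th iterate is the
`n`-th member of the exhaustion of a sublevel set of the Green function. -/
noncomputable def logRadius (p : ℂ[X]) (c r : ℝ) (N n : ℕ) : ℝ :=
  (p.natDegree : ℝ) ^ (N + n) * r - c

include hp hr hN in
theorem logRadius_pos (n : ℕ) : 0 < logRadius p c r N n := by
  have hd : (1 : ℝ) ≤ p.natDegree := by exact_mod_cast (by lia : 1 ≤ p.natDegree)
  have : (p.natDegree : ℝ) ^ N * r ≤ (p.natDegree : ℝ) ^ (N + n) * r := by
    exact mul_le_mul_of_nonneg_right (pow_le_pow_right₀ hd (Nat.le_add_right _ _)) hr.le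
  rw [logRadius]
  linarith

include hc in
-- The relation `c (d - 1) = k` gives exactly the pair `L`, `d L + k` that the interpolation
-- requires.
theorem logRadius_succ (n : ℕ) :
    logRadius p c r N (n + 1) = p.natDegree * logRadius p c r N n + k := by
  rw [logRadius, logRadius, ← hc, ← add_assoc, pow_succ]
  ring

/-- The pieces of the Loewner family of a sublevel set of the Green function. -/
noncomputable def loewnerPiece (p : ℂ[X]) (δ : ℂ) (c r : ℝ) (N n : ℕ) (s : ℝ) (x : Cn 2) : Cn 2 :=
  interpolation p δ (logRadius p c r N n) (logRadius p c r N (n + 1)) s ((henon p δ)^[N + n] x)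

/-- The automorphisms defining the Loewner family of a sublevel set of the Green function. -/
noncomputable def loewnerMap (p : ℂ[X]) (δ : ℂ) (c r : ℝ) (N : ℕ) : ℝ≥0 → Cn 2 → Cn 2 :=
  glue (loewnerPiece p δ c r N)

theorem norm_loewnerMap (t : ℝ≥0) (x : Cn 2) : ‖loewnerMap p δ c r N t x‖ =
    glue (fun n s => ‖loewnerPiece p δ c r N n s x‖) t := rfl

theorem norm_loewnerMap_natCast (n : ℕ) (x : Cn 2) : ‖loewnerMap p δ c r N n x‖ =
    ‖(henon p δ)^[N + n] x‖ / Real.exp (logRadius p c r N n) := by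
  rw [norm_loewnerMap, glue_natCast, loewnerPiece, norm_interpolation_zero]

include hδ in
theorem isAutomorphism_loewnerMap (t : ℝ≥0) : IsAutomorphism (loewnerMap p δ c r N t) :=
  (isAutomorphism_interpolation _ _ _ _ _).comp ((isAutomorphism_henon p hδ).iterate _)

include hδ in
-- The two maps themselves differ by a coordinate swap and a phase; only their norms match, which
-- suffices because the domains depend on norms alone.
theorem norm_loewnerPiece_one (n : ℕ) (x : Cn 2) :
    ‖loewnerPiece p δ c r N n 1 x‖ = ‖loewnerPiece p δ c r N (n + 1) 0 x‖ := by
  rw [loewnerPiece, loewnerPiece, norm_interpolation_zero, norm_interpolation_one p hδ,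
    ← add_assoc, Function.iterate_succ_apply']

include hδ in
theorem continuous_norm_loewnerMap (x : Cn 2) :
    Continuous fun t => ‖loewnerMap p δ c r N t x‖ :=
  continuous_glue (φ := fun n s => ‖loewnerPiece p δ c r N n s x‖) (fun n => norm_loewnerPiece_one hδ n x)
    fun _ => continuous_norm_interpolation _ _ _ _ _

include hδ hp hC hk1 hk2 hk3 hc hr hN in
theorem norm_loewnerMap_lt_one (t s : ℝ≥0) (x : Cn 2) (hts : t < s)
    (ht : ‖loewnerMap p δ c r N t x‖ ≤ 1) : ‖loewnerMap p δ c r N s x‖ < 1 := by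
  refine glue_lt_one (φ := fun n s => ‖loewnerPiece p δ c r N n s x‖)
    (fun n => norm_loewnerPiece_one hδ n x) (fun n s s' h0 h1 h2 h3 => ?_) hts ht
  simp only [loewnerPiece, logRadius_succ hc] at h3 ⊢
  exact norm_interpolation_lt_one hδ hp hC hk1 hk2 hk3 (logRadius_pos hp hr hN n).le h0 h1 h2 h3

include hp hr hN in
theorem norm_loewnerMap_natCast_lt_one_iff (n : ℕ) (x : Cn 2) :
    ‖loewnerMap p δ c r N n x‖ < 1 ↔ greenApprox p δ c (N + n) x < r := by
  have hd : (0 : ℝ) < p.natDegree := by exact_mod_cast (by lia : 0 < p.natDegree)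
  rw [norm_loewnerMap_natCast, div_lt_one (Real.exp_pos _),
    ← posLog_norm_lt_iff (logRadius_pos hp hr hN n), greenApprox, div_lt_iff₀ (by positivity),
    logRadius, lt_sub_iff_add_lt, mul_comm r]

include hp hk1 hk hc in
theorem green_lt_iff (N : ℕ) (x : Cn 2) :
    green p δ x < r ↔ ∃ n, greenApprox p δ c (N + n) x < r := by
  have hk0 : 0 ≤ k := by linarith
  refine ⟨fun h => ?_, fun ⟨n, hn⟩ => (green_le_greenApprox hp hk0 hk hc _ x).trans_lt hn⟩
  obtain ⟨n, hn⟩ := ((tendsto_green hp hk0 hk hc x).2.eventually (gt_mem_nhds h)).exists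
  exact ⟨n, (antitone_greenApprox hp hk0 hk hc x (Nat.le_add_left n N)).trans_lt hn⟩

include hp hk1 hk hc hr hN in
theorem sublevel_eq_iUnion_natCast :
    {x | green p δ x < r} = ⋃ n : ℕ, {x | ‖loewnerMap p δ c r N n x‖ < 1} := by
  ext x
  simp only [Set.mem_iUnion, Set.mem_ofPred_eq, norm_loewnerMap_natCast_lt_one_iff hp hr hN]
  exact green_lt_iff hp hk1 hk hc N x

include hδ hp hC hk1 hk2 hk3 hk hc hr hN in
theorem sublevel_eq_iUnion :
    {x | green p δ x < r} = ⋃ t, {x | ‖loewnerMap p δ c r N t x‖ < 1} := by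
  rw [sublevel_eq_iUnion_natCast hp hk1 hk hc hr hN]
  refine subset_antisymm (Set.iUnion_subset fun n => Set.subset_iUnion_of_subset _ subset_rfl)
    (Set.iUnion_subset fun t x hx => ?_)
  obtain ⟨n, hn⟩ := exists_nat_gt t
  exact Set.mem_iUnion.2
    ⟨n, norm_loewnerMap_lt_one hδ hp hC hk1 hk2 hk3 hc hr hN t n x hn (le_of_lt hx)⟩

include hδ hp hk1 hk hc hr hN in
theorem kobayashiMetric_sublevel {q : Cn 2} (hq : green p δ q < r) (v : Cn 2) :
    kobayashiMetric {x | green p δ x < r} q v = 0 := by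
  have hk0 : 0 ≤ k := by linarith
  have hd : (1 : ℝ) < p.natDegree := by exact_mod_cast (by lia : 1 < p.natDegree)
  -- The gap between `s` and `r` gives the decay: with `m = N + (M + n)`, the quotient of `exp(d^m s
  -- - c)` by the radius `exp(d^m r - c)` is `exp(d^m (s - r))`, which tends to `0`.
  obtain ⟨s, hqs, hsr⟩ := exists_between hq
  have hs : 0 < s := (green_nonneg hp hk0 hk hc q).trans_lt hqs
  obtain ⟨M, hM⟩ := (green_lt_iff hp hk1 hk hc N q).1 hqs
  obtain ⟨η, hη, hball⟩ := Metric.eventually_nhds_iff_ball.1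
    ((continuous_greenApprox p δ c (N + M)).continuousAt.eventually (gt_mem_nhds hM))
  have hlim : Tendsto (fun n : ℕ => Real.exp ((p.natDegree : ℝ) ^ (N + (M + n)) * (s - r)))
      atTop (𝓝 0) := by
    refine Real.tendsto_exp_atBot.comp (Tendsto.atTop_mul_const_of_neg (by linarith) ?_)
    refine (tendsto_pow_atTop_atTop_of_one_lt hd).comp ?_
    exact tendsto_atTop_mono (fun n => (by lia : n ≤ N + (M + n))) tendsto_id
  refine kobayashiMetric_eq_zero_of_tendsto (F := fun n => loewnerMap p δ c r N (M + n : ℕ))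
    (fun n => isAutomorphism_loewnerMap hδ _) (fun n x hx => ?_) hη hlim (fun n x hx => ?_) v
  · rw [sublevel_eq_iUnion_natCast hp hk1 hk hc hr hN]
    exact Set.mem_iUnion.2 ⟨M + n, hx⟩
  · have h1 : greenApprox p δ c (N + (M + n)) x < s :=
      (antitone_greenApprox hp hk0 hk hc x (by lia)).trans_lt (hball x hx)
    rw [greenApprox, div_lt_iff₀ (by positivity)] at h1
    have h2 : ‖(henon p δ)^[N + (M + n)] x‖ ≤
        Real.exp (s * (p.natDegree : ℝ) ^ (N + (M + n)) - c) := by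
      rcases eq_or_ne ((henon p δ)^[N + (M + n)] x) 0 with h0 | h0
      · rw [h0, norm_zero]
        positivity
      · rw [← Real.log_le_iff_le_exp (norm_pos_iff.2 h0)]
        have : Real.log ‖(henon p δ)^[N + (M + n)] x‖ ≤ _ := le_max_right 0 _
        rw [← Real.posLog_apply] at this
        linarith
    rw [norm_loewnerMap_natCast, div_le_iff₀ (Real.exp_pos _), ← Real.exp_add, logRadius]
    refine h2.trans_eq ?_
    ring_nf

include hδ hp hk1 hk hc hr in
theorem exists_green_ne :
    ∃ x, green p δ x < r ∧ ∃ y, green p δ y < r ∧ green p δ x ≠ green p δ y := by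
  have hk0 : 0 ≤ k := by linarith
  have hd : (1 : ℝ) < p.natDegree := by exact_mod_cast (by lia : 1 < p.natDegree)
  obtain ⟨x₀, hx₀⟩ := exists_green_pos hp hk0 hk hc
  -- The inverse map divides the Green function by `d`: iterating it brings a point of positive
  -- value into the sublevel set, and one more application gives a second value there.
  obtain ⟨-, G, -, -, hG⟩ := isAutomorphism_henon p hδ
  have hgreen : ∀ x, green p δ (G x) = green p δ x / p.natDegree := fun x => by
    rw [eq_div_iff (by positivity), mul_comm, ← green_henon hp hk0 hk hc, hG]
  have hiter : ∀ n, green p δ (G^[n] x₀) = green p δ x₀ * (p.natDegree : ℝ)⁻¹ ^ n := by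
    intro n
    induction n with
    | zero => simp
    | succ n ih =>
      rw [Function.iterate_succ_apply', hgreen, ih, pow_succ]
      ring
  have hlim : Tendsto (fun n => green p δ x₀ * (p.natDegree : ℝ)⁻¹ ^ n) atTop (𝓝 0) := by
    simpa using (tendsto_pow_atTop_nhds_zero_of_lt_one (by positivity)
      (inv_lt_one_of_one_lt₀ hd)).const_mul (green p δ x₀)
  obtain ⟨n, hn⟩ := (hlim.eventually (gt_mem_nhds hr)).exists
  rw [← hiter] at hn
  have hpos : 0 < green p δ (G^[n] x₀) := by
    rw [hiter]
    positivity
  have hlt : green p δ (G (G^[n] x₀)) < green p δ (G^[n] x₀) := by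
    rw [hgreen]
    exact div_lt_self hpos hd
  exact ⟨_, hn, _, hlt.trans hn, hlt.ne'⟩

include hδ hp hC hk1 hk2 hk3 hk hc hr hN in
theorem isLoewnerShort_sublevel : IsLoewnerShort {x | green p δ x < r} := by
  have hnest := norm_loewnerMap_lt_one hδ hp hC hk1 hk2 hk3 hc hr hN
  refine ⟨⟨le_rfl, ⟨fun n : ℕ => {x | ‖loewnerMap p δ c r N n x‖ < 1}, ?_, fun n =>
    (isAutomorphism_loewnerMap hδ _).biholomorphic, ?_⟩, fun q hq v => ?_, ?_⟩, ?_⟩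
  · exact monotone_nat_of_le_succ fun n x hx =>
      hnest _ _ x (by exact_mod_cast n.lt_succ_self) (le_of_lt hx)
  · exact sublevel_eq_iUnion_natCast hp hk1 hk hc hr hN
  · exact kobayashiMetric_sublevel hδ hp hk1 hk hc hr hN hq v
  · obtain ⟨x, hx, y, hy, hxy⟩ := exists_green_ne hδ hp hk1 hk hc hr
    exact ⟨fun x => (green p δ x : EReal),
      isPlurisubharmonicOn_green hp (by linarith) hk hc _,
      ⟨r, fun x hx => EReal.coe_le_coe_iff.2 (le_of_lt hx)⟩, x, hx, y, hy,
      fun h => hxy (EReal.coe_eq_coe_iff.1 h)⟩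
  · exact exists_loewner_family (isAutomorphism_loewnerMap hδ) (continuous_norm_loewnerMap hδ)
      hnest (sublevel_eq_iUnion hδ hp hC hk1 hk2 hk3 hk hc hr hN)

end Sublevel

end ShortC

/-- The first conjunct says that the limit defining the Green function exists at every point. -/
theorem mainTheorem5 (p : ℂ[X]) (hp : 2 ≤ p.natDegree) (δ : ℂ) (hδ : δ ≠ 0) :
    (∀ x : ShortC.Cn 2,
      Filter.Tendsto (ShortC.greenSeq p δ x) Filter.atTop (𝓝 (ShortC.green p δ x))) ∧
    ∀ r : ℝ, 0 < r → ShortC.IsLoewnerShort {x : ShortC.Cn 2 | ShortC.green p δ x < r} := by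
  obtain ⟨C, k, c, hC, hk1, hk2, hk3, hk, hc⟩ := ShortC.exists_growth_constants p hp δ
  refine ⟨fun x => (ShortC.tendsto_green hp (by linarith) hk hc x).1, fun r hr => ?_⟩
  have hd : (1 : ℝ) < p.natDegree := by exact_mod_cast (by lia : 1 < p.natDegree)
  -- Starting at this `N` makes every logarithmic radius positive, so that `log⁺ ‖y‖ < L` is
  -- equivalent to `‖y‖ < e^L`.
  obtain ⟨N, hN⟩ := pow_unbounded_of_one_lt (c / r) hd
  exact ShortC.isLoewnerShort_sublevel hδ hp hC hk1 hk2 hk3 hk hc hr ((div_lt_iff₀ hr).1 hN)
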